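/- There is an absolute constant $C>0$ such that the following holds. Let $K\subseteq\mathbb{R}^d$ be a centrally symmetric convex body (compact, convex, $K=-K$) with $B(r)\subseteq K\subseteq B(R)$ for some $r>0$, where $B(\rho)$ denotes the closed Euclidean ball of radius $\rho$ centred at the origin. Let $\mathcal{G}\subseteq\mathbb{R}^d$ be a set of gain vectors such that $G=\max_{g\in\mathcal{G}}\|g\|_2$ exists, and let $\alpha>0$. Consider online linear optimization with hints on $K$: in each round $t$ the algorithm first receives a hint $h_t$ with $\|h_t\|_2=1$, then plays a point $x_t\in K$ that depends only on $h_1,\dots,h_t$ and $g_1,\dots,g_{t-1}$; after that a gain vector $g_t\in\mathcal{G}$ is revealed, for which $\langle h_t,g_t\rangle\ge\alpha\|g_t\|_2$, and the algorithm receives the reward $\langle x_t,g_t\rangle$. Then for every $\varepsilon>0$ there is a deterministic online algorithm (which may depend on $K,r,R,\mathcal{G},\alpha,\varepsilon$, but not on the number of rounds) such that for every $T\ge 2$ and all sequences $h_1,\dots,h_T$ and $g_1,\dots,g_T$ as above $$\sum_{t=1}^T\langle x_t,g_t\rangle\;\ge\;(1-\varepsilon)\,\mathrm{OPT}\;-\;\frac{d\,G\,R^4}{\alpha\,r^3}\cdot\frac{C\,\log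 T}{\varepsilon},\qquad \mathrm{OPT}:=\max_{x\in K}\sum_{t=1}^T\langle x,g_t\rangle .$$ -/

import Mathlib

/-- A deterministic online algorithm for online linear optimization with hints on the playing set
`K`. In round `t` (rounds are numbered from `0`) the algorithm knows the pairs `(hint, gain)` of the
`t` past rounds and the current hint, and it answers with a point of `K`. The gain vector of round
`t` is not available to it. -/
structure HintAlgorithm {d : ℕ} (K : ConvexBody (EuclideanSpace ℝ (Fin d))) where
  /-- `play t past h` is the action in round `t` after the history `past` and the hint `h`. -/
  play : (t : ℕ) → (Fin t → EuclideanSpace ℝ (Fin d) × EuclideanSpace ℝ (Fin d)) →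
    EuclideanSpace ℝ (Fin d) → EuclideanSpace ℝ (Fin d)
  /-- Only feasible actions are played. -/
  play_mem : ∀ t past h, play t past h ∈ K

/-- The action `x_t` of the algorithm against the hints `h` and the gains `g`. -/
def HintAlgorithm.action {d : ℕ} {K : ConvexBody (EuclideanSpace ℝ (Fin d))}
    (A : HintAlgorithm K) (h g : ℕ → EuclideanSpace ℝ (Fin d)) (t : ℕ) :
    EuclideanSpace ℝ (Fin d) :=
  A.play t (fun s => (h s, g s)) (h t)

/-- The total reward `∑_t ⟨x_t, g_t⟩` of the algorithm over the first `T` rounds. -/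
noncomputable def HintAlgorithm.totalReward {d : ℕ} {K : ConvexBody (EuclideanSpace ℝ (Fin d))}
    (A : HintAlgorithm K) (h g : ℕ → EuclideanSpace ℝ (Fin d)) (T : ℕ) : ℝ :=
  ∑ t ∈ Finset.range T, inner ℝ (A.action h g t) (g t)

/-- `OPT`, the maximum over `x ∈ K` of `∑_t ⟨x, g_t⟩` over the first `T` rounds: the reward of the
best fixed action in hindsight. -/
noncomputable def hintOPT {d : ℕ} (K : ConvexBody (EuclideanSpace ℝ (Fin d)))
    (g : ℕ → EuclideanSpace ℝ (Fin d)) (T : ℕ) : ℝ :=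
  sSup ((fun x => ∑ t ∈ Finset.range T, inner ℝ x (g t)) '' (K : Set (EuclideanSpace ℝ (Fin d))))

/-- The supremum that defines `OPT` is attained. -/
theorem hintOPT_isGreatest {d : ℕ} (K : ConvexBody (EuclideanSpace ℝ (Fin d)))
    (g : ℕ → EuclideanSpace ℝ (Fin d)) (T : ℕ) :
    IsGreatest ((fun x => ∑ t ∈ Finset.range T, inner ℝ x (g t)) ''
      (K : Set (EuclideanSpace ℝ (Fin d)))) (hintOPT K g T) :=
  (K.isCompact.image (by fun_prop)).isGreatest_sSup (K.nonempty.image _)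

/-! A gradient ascent step of size `η` loses at most `η / 2 * ‖g‖ ^ 2 ≤ η / 2 * G * ‖g‖` against a
fixed comparator, besides the one-time cost `R ^ 2 / (2 * η)`. Playing `r • h` instead gains at
least `r * α * ‖g‖`. Both are proportional to `‖g‖`, so putting the weight `ε` on the hint pays for
gradient ascent with `η = 2 * ε * r * α / G`, in every round. Only the one-time cost
`G * R ^ 2 / (4 * ε * r * α)` remains, uniformly in the dimension and in the number of rounds. -/

section NearestPoint

variable {E : Type*} [NormedAddCommGroup E] [InnerProductSpace ℝ E] {K : Set E}

/-- A point of `K` at minimal distance from `u`: the metric projection of `u` onto `K`. The value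
is arbitrary if there is no such point; there is one if `K` is nonempty, complete and convex. -/
noncomputable def nearestPoint (K : Set E) (u : E) : E :=
  Classical.epsilon fun v => v ∈ K ∧ ‖u - v‖ = ⨅ w : K, ‖u - w‖

theorem nearestPoint_spec (hne : K.Nonempty) (hc : IsComplete K) (hconv : Convex ℝ K) (u : E) :
    nearestPoint K u ∈ K ∧ ‖u - nearestPoint K u‖ = ⨅ w : K, ‖u - w‖ :=
  Classical.epsilon_spec (exists_norm_eq_iInf_of_complete_convex hne hc hconv u)

theorem nearestPoint_mem (hne : K.Nonempty) (hc : IsComplete K) (hconv : Convex ℝ K) (u : E) :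
    nearestPoint K u ∈ K :=
  (nearestPoint_spec hne hc hconv u).1

theorem norm_nearestPoint_sub_le (hc : IsComplete K) (hconv : Convex ℝ K) (u : E) {w : E}
    (hw : w ∈ K) : ‖nearestPoint K u - w‖ ≤ ‖u - w‖ := by
  obtain ⟨hmem, hmin⟩ := nearestPoint_spec ⟨w, hw⟩ hc hconv u
  have hobtuse : inner ℝ (u - nearestPoint K u) (w - nearestPoint K u) ≤ 0 :=
    (norm_eq_iInf_iff_real_inner_le_zero hconv hmem).1 hmin w hw
  have hpyth := norm_sub_sq_real (u - nearestPoint K u) (w - nearestPoint K u)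
  rw [sub_sub_sub_cancel_right, norm_sub_rev w] at hpyth
  refine le_of_sq_le_sq ?_ (norm_nonneg _)
  linarith [sq_nonneg ‖u - nearestPoint K u‖]

theorem nearestPoint_eq_self (hc : IsComplete K) (hconv : Convex ℝ K) {u : E} (hu : u ∈ K) :
    nearestPoint K u = u := by
  simpa [sub_eq_zero] using norm_nearestPoint_sub_le hc hconv u hu

end NearestPoint

section GradientAscent

variable {E : Type*} [NormedAddCommGroup E] [InnerProductSpace ℝ E]

/-- The iterate of projected gradient ascent on `K`, with constant step size `η` and starting point
`x₀`, after the gain vectors `g 0, …, g (t - 1)`. It takes a finite sequence of gains, so that an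
online algorithm can play it. -/
noncomputable def gradientAscent (K : Set E) (η : ℝ) (x₀ : E) {t : ℕ} (g : Fin t → E) : E :=
  Fin.foldl t (fun x s => nearestPoint K (x + η • g s)) x₀

theorem gradientAscent_zero (K : Set E) (η : ℝ) (x₀ : E) (g : Fin 0 → E) :
    gradientAscent K η x₀ g = x₀ :=
  Fin.foldl_zero _ _

theorem gradientAscent_succ (K : Set E) (η : ℝ) (x₀ : E) {t : ℕ} (g : Fin (t + 1) → E) :
    gradientAscent K η x₀ g =
      nearestPoint K (gradientAscent K η x₀ (fun s : Fin t => g s.castSucc) + η • g (Fin.last t)) :=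
  Fin.foldl_succ_last _ _

variable {K : Set E} {x₀ : E}

theorem gradientAscent_mem (hc : IsComplete K) (hconv : Convex ℝ K) (hx₀ : x₀ ∈ K) (η : ℝ)
    {t : ℕ} (g : Fin t → E) : gradientAscent K η x₀ g ∈ K := by
  cases t with
  | zero => rwa [gradientAscent_zero]
  | succ t =>
    rw [gradientAscent_succ]
    exact nearestPoint_mem ⟨x₀, hx₀⟩ hc hconv _

theorem norm_gradientAscent_sub_sq_le (hc : IsComplete K) (hconv : Convex ℝ K) {w : E}
    (hw : w ∈ K) (η : ℝ) (x₀ : E) (g : ℕ → E) (T : ℕ) :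
    ‖gradientAscent K η x₀ (fun s : Fin T => g s) - w‖ ^ 2 ≤
      ‖x₀ - w‖ ^ 2
        - 2 * η * ∑ t ∈ Finset.range T,
          inner ℝ (w - gradientAscent K η x₀ fun s : Fin t => g s) (g t)
        + η ^ 2 * ∑ t ∈ Finset.range T, ‖g t‖ ^ 2 := by
  induction T with
  | zero => simp [gradientAscent_zero]
  | succ T ih =>
    set x := gradientAscent K η x₀ fun s : Fin T => g s
    calc ‖gradientAscent K η x₀ (fun s : Fin (T + 1) => g s) - w‖ ^ 2
        = ‖nearestPoint K (x + η • g T) - w‖ ^ 2 := by rw [gradientAscent_succ]; rfl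
      _ ≤ ‖x + η • g T - w‖ ^ 2 := by gcongr; exact norm_nearestPoint_sub_le hc hconv _ hw
      _ = ‖x - w‖ ^ 2 - 2 * η * inner ℝ (w - x) (g T) + η ^ 2 * ‖g T‖ ^ 2 := by
        rw [add_sub_right_comm, norm_add_sq_real, ← neg_sub w x, inner_neg_left, norm_neg,
          real_inner_smul_right, norm_smul, mul_pow, Real.norm_eq_abs, sq_abs]
        ring
      _ ≤ _ := by
        rw [Finset.sum_range_succ, Finset.sum_range_succ]
        linarith

theorem gradientAscent_regret_le (hc : IsComplete K) (hconv : Convex ℝ K) {w : E} (hw : w ∈ K)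
    {η : ℝ} (hη : 0 < η) (x₀ : E) (g : ℕ → E) (T : ℕ) :
    ∑ t ∈ Finset.range T, inner ℝ (w - gradientAscent K η x₀ fun s : Fin t => g s) (g t) ≤
      ‖x₀ - w‖ ^ 2 / (2 * η) + η / 2 * ∑ t ∈ Finset.range T, ‖g t‖ ^ 2 := by
  have hpotential := norm_gradientAscent_sub_sq_le hc hconv hw η x₀ g T
  have hnonneg := sq_nonneg ‖gradientAscent K η x₀ (fun s : Fin T => g s) - w‖
  refine le_of_mul_le_mul_left ?_ (mul_pos two_pos hη)
  calc _ ≤ ‖x₀ - w‖ ^ 2 + η ^ 2 * ∑ t ∈ Finset.range T, ‖g t‖ ^ 2 := by linarith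
    _ = _ := by field_simp

end GradientAscent

theorem sum_norm_sq_le_mul_sum_norm {ι E : Type*} [SeminormedAddCommGroup E] {s : Finset ι}
    {g : ι → E} {G : ℝ} (hg : ∀ i ∈ s, ‖g i‖ ≤ G) :
    ∑ i ∈ s, ‖g i‖ ^ 2 ≤ G * ∑ i ∈ s, ‖g i‖ := by
  simp only [Finset.mul_sum, sq]
  exact Finset.sum_le_sum fun i hi => mul_le_mul_of_nonneg_right (hg i hi) (norm_nonneg _)

section HintOPT

variable {d : ℕ} {K : ConvexBody (EuclideanSpace ℝ (Fin d))} {g : ℕ → EuclideanSpace ℝ (Fin d)}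
  {T : ℕ}

theorem hintOPT_le {b : ℝ} (hb : ∀ w ∈ K, ∑ t ∈ Finset.range T, inner ℝ w (g t) ≤ b) :
    hintOPT K g T ≤ b :=
  csSup_le (K.nonempty.image _) (Set.forall_mem_image.2 hb)

theorem hintOPT_nonneg (h0 : 0 ∈ K) : 0 ≤ hintOPT K g T :=
  (hintOPT_isGreatest K g T).2 ⟨0, h0, by simp⟩

theorem hintOPT_nonpos_of_forall_eq_zero (hg : ∀ t < T, g t = 0) : hintOPT K g T ≤ 0 :=
  hintOPT_le fun w _ => (Finset.sum_eq_zero fun t ht => by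
    rw [hg t (Finset.mem_range.1 ht), inner_zero_right]).le

end HintOPT

namespace HintAlgorithm

variable {d : ℕ} {K : ConvexBody (EuclideanSpace ℝ (Fin d))}
  {h g : ℕ → EuclideanSpace ℝ (Fin d)} {T : ℕ}

/-- The algorithm that plays the convex combination of the actions of `A` and `B`, with the weight
`ε` on `B`. -/
noncomputable def mix (A B : HintAlgorithm K) (ε : ℝ) (hε₀ : 0 ≤ ε) (hε₁ : ε ≤ 1) :
    HintAlgorithm K where
  play t past h := (1 - ε) • A.play t past h + ε • B.play t past h
  play_mem t past h :=
    K.convex (A.play_mem t past h) (B.play_mem t past h) (sub_nonneg.2 hε₁) hε₀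
      (sub_add_cancel 1 ε)

theorem totalReward_mix (A B : HintAlgorithm K) {ε : ℝ} (hε₀ : 0 ≤ ε) (hε₁ : ε ≤ 1)
    (h g : ℕ → EuclideanSpace ℝ (Fin d)) (T : ℕ) :
    (A.mix B ε hε₀ hε₁).totalReward h g T =
      (1 - ε) * A.totalReward h g T + ε * B.totalReward h g T := by
  simp only [totalReward, action, mix, inner_add_left, real_inner_smul_left,
    Finset.sum_add_distrib, Finset.mul_sum]

/-- The algorithm that plays `ρ • h` on the hint `h`, projected onto `K`. -/
noncomputable def followHint (K : ConvexBody (EuclideanSpace ℝ (Fin d))) (ρ : ℝ) :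
    HintAlgorithm K where
  play _ _ h := nearestPoint K (ρ • h)
  play_mem _ _ _ := nearestPoint_mem K.nonempty K.isCompact.isComplete K.convex _

theorem le_totalReward_followHint {r α : ℝ} (hr : 0 ≤ r)
    (hrK : Metric.closedBall (0 : EuclideanSpace ℝ (Fin d)) r ⊆ (K : Set _))
    (hh : ∀ t < T, ‖h t‖ ≤ 1) (hhg : ∀ t < T, α * ‖g t‖ ≤ inner ℝ (h t) (g t)) :
    r * α * ∑ t ∈ Finset.range T, ‖g t‖ ≤ (followHint K r).totalReward h g T := by
  rw [totalReward, Finset.mul_sum]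
  refine Finset.sum_le_sum fun t ht => ?_
  rw [Finset.mem_range] at ht
  have hmem : r • h t ∈ (K : Set _) := hrK <| by
    rw [mem_closedBall_zero_iff, norm_smul, Real.norm_of_nonneg hr]
    exact mul_le_of_le_one_right hr (hh t ht)
  have hplay : (followHint K r).action h g t = r • h t :=
    nearestPoint_eq_self K.isCompact.isComplete K.convex hmem
  rw [hplay, real_inner_smul_left, mul_assoc]
  exact mul_le_mul_of_nonneg_left (hhg t ht) hr

/-- The algorithm that ignores the hints and plays projected gradient ascent on the past gains. -/
noncomputable def ascend (K : ConvexBody (EuclideanSpace ℝ (Fin d))) (η : ℝ)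
    (x₀ : EuclideanSpace ℝ (Fin d)) (hx₀ : x₀ ∈ K) : HintAlgorithm K where
  play _ past _ := gradientAscent K η x₀ fun s => (past s).2
  play_mem _ _ _ := gradientAscent_mem K.isCompact.isComplete K.convex hx₀ η _

theorem hintOPT_le_totalReward_ascend {η R : ℝ} (hη : 0 < η) {x₀ : EuclideanSpace ℝ (Fin d)}
    (hx₀ : x₀ ∈ K) (hKR : (K : Set _) ⊆ Metric.closedBall x₀ R)
    (h g : ℕ → EuclideanSpace ℝ (Fin d)) (T : ℕ) :
    hintOPT K g T ≤ (ascend K η x₀ hx₀).totalReward h g T +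
      (R ^ 2 / (2 * η) + η / 2 * ∑ t ∈ Finset.range T, ‖g t‖ ^ 2) := by
  refine hintOPT_le fun w hw => sub_le_iff_le_add'.1 ?_
  have hwR : ‖x₀ - w‖ ≤ R := mem_closedBall_iff_norm'.1 (hKR hw)
  calc ∑ t ∈ Finset.range T, inner ℝ w (g t) - (ascend K η x₀ hx₀).totalReward h g T
      = ∑ t ∈ Finset.range T,
          inner ℝ (w - gradientAscent K η x₀ fun s : Fin t => g s) (g t) := by
        simp only [inner_sub_left, Finset.sum_sub_distrib]
        rfl
    _ ≤ ‖x₀ - w‖ ^ 2 / (2 * η) + η / 2 * ∑ t ∈ Finset.range T, ‖g t‖ ^ 2 :=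
        gradientAscent_regret_le K.isCompact.isComplete K.convex hw hη x₀ g T
    _ ≤ _ := by gcongr

theorem le_totalReward_mix_ascend_followHint {r R G α ε : ℝ} (hr : 0 < r)
    (hrK : Metric.closedBall (0 : EuclideanSpace ℝ (Fin d)) r ⊆ (K : Set _))
    (hKR : (K : Set _) ⊆ Metric.closedBall (0 : EuclideanSpace ℝ (Fin d)) R)
    (h0 : 0 ∈ K) (hG : 0 < G) (hα : 0 < α) (hε₀ : 0 < ε) (hε₁ : ε ≤ 1)
    (hg : ∀ t < T, ‖g t‖ ≤ G) (hh : ∀ t < T, ‖h t‖ ≤ 1)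
    (hhg : ∀ t < T, α * ‖g t‖ ≤ inner ℝ (h t) (g t)) :
    (1 - ε) * hintOPT K g T - G * R ^ 2 / (4 * ε * r * α) ≤
      ((ascend K (2 * ε * r * α / G) 0 h0).mix (followHint K r) ε hε₀.le hε₁).totalReward
        h g T := by
  set η := 2 * ε * r * α / G with hη
  set N := ∑ t ∈ Finset.range T, ‖g t‖
  set P := G * R ^ 2 / (4 * ε * r * α)
  have hsq : ∑ t ∈ Finset.range T, ‖g t‖ ^ 2 ≤ G * N :=
    sum_norm_sq_le_mul_sum_norm fun t ht => hg t (Finset.mem_range.1 ht)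
  have hascend : hintOPT K g T - P - ε * r * α * N ≤ (ascend K η 0 h0).totalReward h g T := by
    have hregret := hintOPT_le_totalReward_ascend (by positivity : 0 < η) h0 hKR h g T
    have hstart : R ^ 2 / (2 * η) = P := by simp only [hη, P]; field_simp; norm_num
    have hsteps : η / 2 * ∑ t ∈ Finset.range T, ‖g t‖ ^ 2 ≤ ε * r * α * N := calc
      _ ≤ η / 2 * (G * N) := by gcongr
      _ = ε * r * α * N := by rw [hη]; field_simp
    linarith
  have hslack : 0 ≤ ε * P + ε * (ε * r * α * N) := by simp only [P, N]; positivity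
  calc (1 - ε) * hintOPT K g T - P
      ≤ (1 - ε) * (hintOPT K g T - P - ε * r * α * N) + ε * (r * α * N) := by linarith
    _ ≤ (1 - ε) * (ascend K η 0 h0).totalReward h g T
          + ε * (followHint K r).totalReward h g T :=
        add_le_add (mul_le_mul_of_nonneg_left hascend (sub_nonneg.2 hε₁))
          (mul_le_mul_of_nonneg_left (le_totalReward_followHint hr.le hrK hh hhg) hε₀.le)
    _ = _ := (totalReward_mix _ _ _ _ _ _ _).symm

end HintAlgorithm

theorem le_of_closedBall_zero_subset_closedBall_zero {E : Type*} [NormedAddCommGroup E]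
    [NormedSpace ℝ E] [Nontrivial E] {r R : ℝ} (hr : 0 ≤ r)
    (hrR : Metric.closedBall (0 : E) r ⊆ Metric.closedBall 0 R) : r ≤ R := by
  obtain ⟨v, hv⟩ := exists_norm_eq E hr
  simpa [hv] using hrR (mem_closedBall_zero_iff.2 hv.le)

theorem ascent_cost_le_finrank_mul_log {E : Type*} [NormedAddCommGroup E] [NormedSpace ℝ E]
    [FiniteDimensional ℝ E] [Nontrivial E] {r R G α ε T : ℝ} (hr : 0 < r)
    (hrR : Metric.closedBall (0 : E) r ⊆ Metric.closedBall 0 R) (hG : 0 ≤ G) (hα : 0 < α)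
    (hε : 0 < ε) (hT : 2 ≤ T) :
    G * R ^ 2 / (4 * ε * r * α) ≤
      Module.finrank ℝ E * G * R ^ 4 / (α * r ^ 3) * (Real.log T / ε) := by
  have hlog : 1 / 4 ≤ Real.log T := calc
    (1 / 4 : ℝ) ≤ Real.log 2 := by linarith [Real.log_two_gt_d9]
    _ ≤ Real.log T := Real.log_le_log two_pos hT
  have hdim : (1 : ℝ) ≤ Module.finrank ℝ E := by exact_mod_cast (Module.finrank_pos : 0 < _)
  have hratio : 1 ≤ R ^ 2 / r ^ 2 := by
    have := le_of_closedBall_zero_subset_closedBall_zero hr.le hrR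
    exact (one_le_div (by positivity)).2 (by gcongr)
  calc G * R ^ 2 / (4 * ε * r * α)
      = G * R ^ 2 / (ε * r * α) * (1 * 1 * (1 / 4)) := by field_simp
    _ ≤ G * R ^ 2 / (ε * r * α) * (Module.finrank ℝ E * (R ^ 2 / r ^ 2) * Real.log T) := by
        gcongr
    _ = _ := by field_simp

theorem mainTheorem5_general {d : ℕ} (K : ConvexBody (EuclideanSpace ℝ (Fin d))) {r R : ℝ}
    (hr : 0 < r) (hrK : Metric.closedBall (0 : EuclideanSpace ℝ (Fin d)) r ⊆ (K : Set _))
    (hKR : (K : Set _) ⊆ Metric.closedBall (0 : EuclideanSpace ℝ (Fin d)) R)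
    {G α ε : ℝ} (hG : 0 ≤ G) (hα : 0 < α) (hε : 0 < ε) :
    ∃ A : HintAlgorithm K, ∀ (T : ℕ) (h g : ℕ → EuclideanSpace ℝ (Fin d)),
      (∀ t < T, ‖g t‖ ≤ G) →
      (∀ t < T, ‖h t‖ ≤ 1) →
      (∀ t < T, α * ‖g t‖ ≤ inner ℝ (h t) (g t)) →
      (1 - ε) * hintOPT K g T - G * R ^ 2 / (4 * ε * r * α) ≤ A.totalReward h g T := by
  have h0 : 0 ∈ K := hrK (Metric.mem_closedBall_self hr.le)
  by_cases hmain : 0 < G ∧ ε ≤ 1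
  · exact ⟨_, fun T h g hg hh hhg => HintAlgorithm.le_totalReward_mix_ascend_followHint hr hrK hKR
      h0 hmain.1 hα hε hmain.2 hg hh hhg⟩
  refine ⟨HintAlgorithm.followHint K r, fun T h g hg hh hhg => ?_⟩
  have hOPT : (1 - ε) * hintOPT K g T ≤ 0 := by
    rcases le_or_gt ε 1 with hε₁ | hε₁
    · have hG0 : G = 0 := (not_lt.1 fun hlt => hmain ⟨hlt, hε₁⟩).antisymm hG
      refine mul_nonpos_of_nonneg_of_nonpos (sub_nonneg.2 hε₁) ?_
      exact hintOPT_nonpos_of_forall_eq_zero fun t ht => norm_le_zero_iff.1 (hG0 ▸ hg t ht)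
    · exact mul_nonpos_of_nonpos_of_nonneg (sub_nonpos.2 hε₁.le) (hintOPT_nonneg h0)
  calc (1 - ε) * hintOPT K g T - G * R ^ 2 / (4 * ε * r * α)
      ≤ 0 := sub_nonpos.2 (hOPT.trans (by positivity))
    _ ≤ r * α * ∑ t ∈ Finset.range T, ‖g t‖ := by positivity
    _ ≤ _ := HintAlgorithm.le_totalReward_followHint hr.le hrK hh hhg

theorem mainTheorem5 :
    ∃ C : ℝ, 0 < C ∧
      ∀ (d : ℕ) (K : ConvexBody (EuclideanSpace ℝ (Fin d))) (r R : ℝ),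
        0 < r →
        (∀ x ∈ K, -x ∈ K) →
        Metric.closedBall (0 : EuclideanSpace ℝ (Fin d)) r ⊆ (K : Set _) →
        (K : Set _) ⊆ Metric.closedBall (0 : EuclideanSpace ℝ (Fin d)) R →
      ∀ (𝒢 : Set (EuclideanSpace ℝ (Fin d))) (G α : ℝ),
        IsGreatest ((fun v => ‖v‖) '' 𝒢) G →
        0 < α →
      ∀ ε : ℝ, 0 < ε →
        ∃ A : HintAlgorithm K,
          ∀ T : ℕ, 2 ≤ T →
          ∀ h g : ℕ → EuclideanSpace ℝ (Fin d),
            (∀ t < T, g t ∈ 𝒢) →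
            (∀ t < T, ‖h t‖ = 1) →
            (∀ t < T, α * ‖g t‖ ≤ inner ℝ (h t) (g t)) →
            (1 - ε) * hintOPT K g T
                - (d : ℝ) * G * R ^ 4 / (α * r ^ 3) * (C * (Real.log T / ε))
              ≤ A.totalReward h g T := by
  refine ⟨1, one_pos, fun d K r R hr _ hrK hKR 𝒢 G α hG hα ε hε => ?_⟩
  have hG₀ : 0 ≤ G := hG.1.elim fun v hv => hv.2 ▸ norm_nonneg v
  obtain ⟨A, hA⟩ := mainTheorem5_general K hr hrK hKR hG₀ hα hε
  refine ⟨A, fun T hT h g hg hh hhg => ?_⟩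
  have : Nontrivial (EuclideanSpace ℝ (Fin d)) :=
    nontrivial_of_ne (h 0) 0 (norm_ne_zero_iff.1 (by simp [hh 0 (by omega)]))
  have hcost := ascent_cost_le_finrank_mul_log hr (hrK.trans hKR) hG₀ hα hε
    (by exact_mod_cast hT : (2 : ℝ) ≤ T)
  rw [finrank_euclideanSpace_fin] at hcost
  rw [one_mul]
  exact (sub_le_sub_left hcost _).trans
    (hA T h g (fun t ht => hG.2 ⟨g t, hg t ht, rfl⟩) (fun t ht => (hh t ht).le) hhg)
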